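/- Let $G=(V,E)$ be a finite connected simple undirected graph, $\partial i$ the set of neighbours of $i\in V$, and $(a_i)_{i\in V}$ real numbers. In the Gaussian sampling model on $G$ the state is $\theta\sim N(0,1)$; given $\theta$, the private signals $S_i\sim N(a_i\theta,1)$, $i\in V$, are independent. At each time $t=0,1,2,\dots$, agent $i$ has observed $H_i(t)=\bigl(S_i,(Y_j(s))_{j\in\partial i,\,s<t}\bigr)$, has the posterior $\nu_i(t)=\mathrm{Law}(\theta\mid H_i(t))$, and sends to its neighbours a sample $Y_i(t)$ whose conditional law given $H_i(t)$ is $\nu_i(t)$ and which, given $H_i(t)$, is conditionally independent of all other information (that is, of $\theta$, of all signals, of all samples sent before time $t$, and of the samples of the other agents at time $t$). Then, for every agent $i\in V$, the posteriors are normal with deterministic variances, $\nu_i(t)=N(X_i(t),\sigma_i(t))$ almost surely for every $t$, where $X_i(t)$ is the (random) posterior mean and $\sigma_i(t)$ the posterior variance, and, as $t\to\infty$, $$\sigma_i(t)\to\frac{1}{\sum_{j\in V}a_j^2+1},\qquad X_i(t)\to\frac{\sum_{j\in V}a_jS_j}{\sum_{j\in V}a_j^2+1},$$ where the second convergence holds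 almost surely and in $L^2$. -/

import Mathlib

open MeasureTheory ProbabilityTheory Filter Topology
open scoped NNReal ENNReal

section SamplingModel

variable {V Ω : Type*} [MeasurableSpace Ω]

/-- `H_i(t) = (S_i, (Y_j(s))_{j ∈ ∂i, s < t})`: everything agent `i` has observed by time `t`, namely
its own private signal and the messages sent by its neighbours at the times `0, …, t - 1`. -/
def agentHistory (G : SimpleGraph V) (S : V → Ω → ℝ) (Y : V → ℕ → Ω → ℝ) (i : V) (t : ℕ) (ω : Ω) :
    ℝ × (G.neighborSet i → Fin t → ℝ) :=
  (S i ω, fun j s => Y j s ω)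

/-- `ν_i(t) = Law(θ | H_i(t))`: the (random) posterior distribution of agent `i` at time `t`. -/
noncomputable def agentPosterior (G : SimpleGraph V) (P : Measure Ω) [IsFiniteMeasure P] (θ : Ω → ℝ)
    (S : V → Ω → ℝ) (Y : V → ℕ → Ω → ℝ) (i : V) (t : ℕ) (ω : Ω) : Measure ℝ :=
  condDistrib θ (agentHistory G S Y i t) P (agentHistory G S Y i t ω)

/-- `X_i(t)`: the mean of the posterior distribution of agent `i` at time `t`. -/
noncomputable def posteriorMean (G : SimpleGraph V) (P : Measure Ω) [IsFiniteMeasure P] (θ : Ω → ℝ)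
    (S : V → Ω → ℝ) (Y : V → ℕ → Ω → ℝ) (i : V) (t : ℕ) (ω : Ω) : ℝ :=
  ∫ x, x ∂(agentPosterior G P θ S Y i t ω)

/-- All the random variables realised up to and including time `t`, except the sample `Y_i(t)`:
the state, all the signals, all the samples at the times `s < t`, and the samples of the agents
`j ≠ i` at time `t`. -/
def otherInfo (θ : Ω → ℝ) (S : V → Ω → ℝ) (Y : V → ℕ → Ω → ℝ) (i : V) (t : ℕ) (ω : Ω) :
    ℝ × (V → ℝ) × (V → Fin t → ℝ) × ({j : V // j ≠ i} → ℝ) :=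
  (θ ω, fun j => S j ω, fun j s => Y j s ω, fun j => Y j t ω)

/-- The sampling model on the network `G` with prior `ν` and signal structure `Q i x = ℙ_i(· | x)`:
the random variables `θ` (the state), `S i` (the private signals) and `Y i t` (the message that
agent `i` sends to its neighbours at time `t`) on the probability space `(Ω, P)` satisfy
* `θ ∼ ν`;
* given `θ`, the signals are independent, and `S i` has law `Q i θ`;
* given `H_i(t)`, the sample `Y i t` has law `ν_i(t) = Law(θ | H_i(t))`, and it is conditionally
  independent of all other information; that is, the conditional law of `Y i t` given all
  other information (of which `H_i(t)` is a part) is `ν_i(t)`. -/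
structure IsSamplingModel [Fintype V] (G : SimpleGraph V) (ν : Measure ℝ) (Q : V → ℝ → Measure ℝ)
    (P : Measure Ω) [IsProbabilityMeasure P] (θ : Ω → ℝ) (S : V → Ω → ℝ) (Y : V → ℕ → Ω → ℝ) :
    Prop where
  measurable_state : Measurable θ
  measurable_signal : ∀ i, Measurable (S i)
  measurable_sample : ∀ i t, Measurable (Y i t)
  law_state : P.map θ = ν
  law_signal : ∀ᵐ ω ∂P,
    condDistrib (fun ω i => S i ω) θ P (θ ω) = Measure.pi (fun i => Q i (θ ω))
  law_sample : ∀ i t, ∀ᵐ ω ∂P,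
    condDistrib (Y i t) (otherInfo θ S Y i t) P (otherInfo θ S Y i t ω) = agentPosterior G P θ S Y i t ω

end SamplingModel

/-!
The proof reduces the theorem to a statement about orthogonal projections in a Hilbert space.

*Gaussian part.* The state, the signals and all messages are jointly Gaussian. This holds for the
state and the signals because the noise `∑ u_j (S_j - a_j θ)` in a combination of signals is normal
and independent of `θ` (`signalNoise_indepFun_map`), and it propagates in time: if everything that
precedes time `t` is Gaussian, then the linear regression `x` of `θ` on the observations of an agent
leaves an error that is uncorrelated with, hence independent of, the observations, so the posterior
is `N(x, v)` with the deterministic variance `v` of the error (`exists_isLinearPosterior`).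
The message of the agent is then `x` plus an `N(0, v)` noise that is independent of all other
information, so the past remains Gaussian after each message (`isCenteredGaussianSpace_succ`).
Both steps rest on the fact that a conditional law `N(g X, v)` means an independent `N(0, v)` error
(`condDistrib_eq_gaussianReal_iff`).

*Hilbert space part* (`tendsto_projection_of_connected`). In `L²`, the estimates of agent `i` are
the projections of `θ` on an increasing sequence of subspaces, hence converge to the projection
`x_i` on the closed span `L_i` of all observations of `i`. The noises of the messages of a
neighbour `j` are bounded and orthogonal, so the averages of these messages converge to `x_j`, which
therefore lies in `L_i`. By symmetry neighbours are equally close to `θ`, so `x_i = x_j`, and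
by connectedness there is a common limit `x`. Its error is orthogonal to every signal; the error of
the full-information estimate is orthogonal to every signal and, by induction on time, to every
message. As that estimate is a combination of signals and `x` a limit of combinations of signals
and messages, the two agree.

Almost sure convergence follows from Lévy's upward theorem, the almost sure limit being identified
along a subsequence by the `L²` limit.
-/

/-! ### Best approximations on a connected network -/

section Hilbert

variable {E : Type*} [NormedAddCommGroup E] [InnerProductSpace ℝ E]

open scoped InnerProductSpace

/-- Law of large numbers for bounded, pairwise orthogonal vectors. -/
lemma tendsto_cesaro_of_orthogonal {z : ℕ → E} {C : ℝ} (hz : ∀ t, ‖z t‖ ≤ C)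
    (horth : ∀ t, ∀ r < t, ⟪z t, z r⟫_ℝ = 0) :
    Tendsto (fun n : ℕ => (n⁻¹ : ℝ) • ∑ t ∈ Finset.range n, z t) atTop (𝓝 0) := by
  have hsum : ∀ n : ℕ, ‖∑ t ∈ Finset.range n, z t‖ ^ 2 ≤ n * C ^ 2 := by
    intro n
    induction n with
    | zero => simp
    | succ n ih =>
      have h0 : ⟪∑ t ∈ Finset.range n, z t, z n⟫_ℝ = 0 := by
        rw [sum_inner]
        refine Finset.sum_eq_zero fun r hr => ?_
        rw [real_inner_comm]
        exact horth n r (Finset.mem_range.1 hr)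
      have h1 : ‖z n‖ ^ 2 ≤ C ^ 2 := pow_le_pow_left₀ (norm_nonneg _) (hz n) 2
      rw [Finset.sum_range_succ, norm_add_sq_real, h0]
      push_cast
      linarith
  have hsq : Tendsto (fun n : ℕ => ‖(n⁻¹ : ℝ) • ∑ t ∈ Finset.range n, z t‖ ^ 2) atTop (𝓝 0) := by
    refine squeeze_zero' (Eventually.of_forall fun n => by positivity) ?_
      (tendsto_const_div_atTop_nhds_zero_nat (C ^ 2))
    filter_upwards [eventually_gt_atTop 0] with n hn
    have hn' : (0 : ℝ) < n := by exact_mod_cast hn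
    rw [norm_smul, mul_pow, norm_inv, Real.norm_natCast, inv_pow, inv_mul_le_iff₀ (by positivity)]
    calc _ ≤ _ := hsum n
      _ = _ := by field_simp
  rw [tendsto_zero_iff_norm_tendsto_zero]
  simpa using hsq.sqrt

variable [CompleteSpace E] {V : Type*} [Finite V]

/-- Abstract form of learning on a connected network. Agent `i` holds the best approximation `x i t`
of `θ` among the combinations of `s i` and of the earlier messages of the neighbours, and sends
`y i t`. The noise `y i t - x i t` is orthogonal to everything that precedes it and has the same norm
as the error `θ - x i t`. Then every agent reaches the best approximation `xs` of `θ` by the whole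
family `s`. -/
theorem tendsto_projection_of_connected {G : SimpleGraph V} (hG : G.Connected) {θ xs : E}
    {s : V → E} {x y : V → ℕ → E}
    (hx_mem : ∀ i t, x i t ∈
      Submodule.span ℝ (insert (s i) {f | ∃ j r, G.Adj i j ∧ r < t ∧ f = y j r}))
    (hx_orth_s : ∀ i t, ⟪θ - x i t, s i⟫_ℝ = 0)
    (hx_orth_y : ∀ i t j r, G.Adj i j → r < t → ⟪θ - x i t, y j r⟫_ℝ = 0)
    (hz_θ : ∀ i t, ⟪y i t - x i t, θ⟫_ℝ = 0)
    (hz_s : ∀ i t j, ⟪y i t - x i t, s j⟫_ℝ = 0)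
    (hz_y : ∀ i t j r, r < t → ⟪y i t - x i t, y j r⟫_ℝ = 0)
    (hz_norm : ∀ i t, ‖y i t - x i t‖ = ‖θ - x i t‖)
    (hxs_mem : xs ∈ Submodule.span ℝ (Set.range s))
    (hxs_orth : ∀ j, ⟪θ - xs, s j⟫_ℝ = 0) (i : V) :
    Tendsto (x i) atTop (𝓝 xs) := by
  set K : V → ℕ → Submodule ℝ E := fun i t =>
    Submodule.span ℝ (insert (s i) {f | ∃ j r, G.Adj i j ∧ r < t ∧ f = y j r}) with hK
  have hKmono : ∀ i, Monotone (K i) := fun i t t' htt => Submodule.span_mono <|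
    Set.insert_subset_insert fun f ⟨j, r, h1, h2, h3⟩ => ⟨j, r, h1, h2.trans_le htt, h3⟩
  -- A vector orthogonal to the generators of `K i t` is orthogonal to `K i t`.
  have hKorth : ∀ i t u, ⟪u, s i⟫_ℝ = 0 → (∀ j r, G.Adj i j → r < t → ⟪u, y j r⟫_ℝ = 0) →
      ∀ f ∈ K i t, ⟪u, f⟫_ℝ = 0 := by
    intro i t u h1 h2 f hf
    have : K i t ≤ LinearMap.ker (innerₛₗ ℝ u) := by
      rw [hK, Submodule.span_le, Set.insert_subset_iff]
      refine ⟨by simpa using h1, ?_⟩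
      rintro f ⟨j, r, hij, hr, rfl⟩
      simpa using h2 j r hij hr
    simpa using this hf
  have hKfin : ∀ i t, FiniteDimensional ℝ (K i t) := fun i t => by
    refine FiniteDimensional.span_of_finite ℝ (Set.Finite.insert _ ?_)
    refine (Set.finite_range fun p : V × Fin t => y p.1 p.2).subset ?_
    rintro f ⟨j, r, -, hr, rfl⟩
    exact ⟨(j, ⟨r, hr⟩), rfl⟩
  set L : V → Submodule ℝ E := fun i => (⨆ t, K i t).topologicalClosure with hL
  have hKL : ∀ i t, K i t ≤ L i := fun i t =>
    (le_iSup (K i) t).trans (Submodule.le_topologicalClosure _)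
  have hLorth : ∀ i u, (∀ t, ∀ f ∈ K i t, ⟪u, f⟫_ℝ = 0) → ∀ f ∈ L i, ⟪u, f⟫_ℝ = 0 := by
    intro i u h f hf
    have hle : L i ≤ (ℝ ∙ u)ᗮ := by
      refine Submodule.topologicalClosure_minimal _ (iSup_le fun t f hf => ?_)
        (Submodule.isClosed_orthogonal _)
      exact Submodule.mem_orthogonal_singleton_iff_inner_right.2 (h t f hf)
    exact Submodule.mem_orthogonal_singleton_iff_inner_right.1 (hle hf)
  have hLproj : ∀ i, (L i).HasOrthogonalProjection := fun i =>
    have : CompleteSpace (L i) := (Submodule.isClosed_topologicalClosure _).completeSpace_coe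
    inferInstance
  have hxK : ∀ i t, x i t = (K i t).starProjection θ := fun i t =>
    (Submodule.eq_starProjection_of_mem_of_inner_eq_zero (hx_mem i t)
      (hKorth i t _ (hx_orth_s i t) (hx_orth_y i t))).symm
  set x' : V → E := fun i => (L i).starProjection θ with hx'
  have hlim : ∀ i, Tendsto (x i) atTop (𝓝 (x' i)) := fun i => by
    have := Submodule.starProjection_tendsto_closure_iSup (K i) (hKmono i) θ
    simpa only [← hxK] using this
  have hx'L : ∀ i, x' i ∈ L i := fun i => Submodule.starProjection_apply_mem _ _
  have hx'orth : ∀ i, ∀ f ∈ L i, ⟪θ - x' i, f⟫_ℝ = 0 := fun i f hf =>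
    Submodule.starProjection_inner_eq_zero θ f hf
  -- The errors of the messages are bounded and pairwise orthogonal, so the averages of the
  -- messages of `j` have the same limit as the estimates of `j`.
  have hz_x : ∀ i t f, f ∈ K i t → ⟪y i t - x i t, f⟫_ℝ = 0 := fun i t =>
    hKorth i t _ (hz_s i t i) fun j r _ hr => hz_y i t j r hr
  have hcesaro : ∀ j, Tendsto (fun n : ℕ => (n⁻¹ : ℝ) • ∑ t ∈ Finset.range n, y j t) atTop
      (𝓝 (x' j)) := by
    intro j
    have hz : Tendsto (fun n : ℕ => (n⁻¹ : ℝ) • ∑ t ∈ Finset.range n, (y j t - x j t)) atTop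
        (𝓝 0) := by
      refine tendsto_cesaro_of_orthogonal (C := ‖θ‖) (fun t => ?_) fun t r hr => ?_
      · rw [hz_norm, hxK]
        simpa using! (K j t)ᗮ.norm_starProjection_apply_le θ
      · rw [inner_sub_right, hz_y j t j r hr, hz_x j t _ (hKmono j hr.le (hx_mem j r)), sub_zero]
    have := hz.add (hlim j).cesaro_smul
    simpa [← smul_add, ← Finset.sum_add_distrib] using this
  have hnbr_mem : ∀ i j, G.Adj i j → x' j ∈ L i := by
    intro i j hij
    refine (Submodule.isClosed_topologicalClosure _).mem_of_tendsto (hcesaro j)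
      (Eventually.of_forall fun n => ?_)
    refine Submodule.smul_mem _ _ (Submodule.sum_mem _ fun t _ => hKL i (t + 1) ?_)
    exact Submodule.subset_span (Or.inr ⟨j, t, hij, t.lt_succ_self, rfl⟩)
  -- Each of two neighbours is at least as close to `θ` as the other one.
  have hnbr : ∀ i j, G.Adj i j → x' i = x' j := by
    intro i j hij
    have h1 := hx'orth i _ (hnbr_mem i j hij)
    have h2 := hx'orth i _ (hx'L i)
    have h3 := hx'orth j _ (hnbr_mem j i hij.symm)
    have h4 := hx'orth j _ (hx'L j)
    rw [← sub_eq_zero, ← inner_self_eq_zero (𝕜 := ℝ)]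
    simp only [inner_sub_left, inner_sub_right] at *
    rw [real_inner_comm (x' i) (x' j)] at *
    linarith
  have hall : ∀ j, x' i = x' j := fun j => by
    obtain ⟨p⟩ := hG.preconnected i j
    induction p with
    | nil => rfl
    | cons h _ ih => exact (hnbr _ _ h).trans ih
  -- By induction on time, no message carries information on `θ` beyond that of `s`.
  have hspan_s : ∀ u, (∀ j, ⟪u, s j⟫_ℝ = 0) → ⟪u, xs⟫_ℝ = 0 := by
    intro u hu
    have : Submodule.span ℝ (Set.range s) ≤ (ℝ ∙ u)ᗮ := by
      rw [Submodule.span_le]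
      rintro _ ⟨j, rfl⟩
      exact Submodule.mem_orthogonal_singleton_iff_inner_right.2 (hu j)
    exact Submodule.mem_orthogonal_singleton_iff_inner_right.1 (this hxs_mem)
  have hxs_y : ∀ t j, ⟪θ - xs, y j t⟫_ℝ = 0 := by
    intro t
    induction t using Nat.strong_induction_on with
    | _ t ih =>
      intro j
      have h1 := hKorth j t (θ - xs) (hxs_orth j) (fun k r _ hr => ih r hr k) _ (hx_mem j t)
      have h2 : ⟪θ - xs, y j t - x j t⟫_ℝ = 0 := by
        rw [real_inner_comm, inner_sub_right, hz_θ, hspan_s _ (hz_s j t), sub_zero]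
      rw [inner_sub_right] at h2
      linarith
  have hxs_L : ∀ j, ∀ f ∈ L j, ⟪θ - xs, f⟫_ℝ = 0 := fun j =>
    hLorth j _ fun t => hKorth j t _ (hxs_orth j) fun k r _ _ => hxs_y r k
  have hx's : ⟪θ - x' i, xs⟫_ℝ = 0 := hspan_s _ fun j => by
    rw [hall j]
    exact hx'orth j _ (hKL j 0 (Submodule.subset_span (Set.mem_insert _ _)))
  suffices x' i = xs from this ▸ hlim i
  have h1 := hx'orth i _ (hx'L i)
  have h2 := hxs_L i _ (hx'L i)
  have h3 := hspan_s _ hxs_orth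
  rw [← sub_eq_zero, ← inner_self_eq_zero (𝕜 := ℝ)]
  simp only [inner_sub_left, inner_sub_right] at *
  rw [real_inner_comm (x' i) xs] at *
  linarith

end Hilbert

/-! ### Conditional laws with independent Gaussian errors -/

section GaussianConditioning

variable {Ω β : Type*} [MeasurableSpace Ω] [MeasurableSpace β] {P : Measure Ω}
  [IsProbabilityMeasure P]

/-- The kernel `x ↦ N(g x, v)`: normal laws with a mean that depends on `x` and a fixed
variance `v`. -/
noncomputable def gaussianKernel (g : β → ℝ) (hg : Measurable g) (v : ℝ≥0) : Kernel β ℝ where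
  toFun x := gaussianReal (g x) v
  measurable' := by fun_prop

instance (g : β → ℝ) (hg : Measurable g) (v : ℝ≥0) : IsMarkovKernel (gaussianKernel g hg v) :=
  ⟨fun x => inferInstanceAs (IsProbabilityMeasure (gaussianReal (g x) v))⟩

/-- Shifting an independent `N(0, v)` variable by `g x` gives the joint law whose conditional laws
are `N(g x, v)`. -/
lemma map_shear_prod_gaussianReal (μ : Measure β) [IsProbabilityMeasure μ] {g : β → ℝ}
    (hg : Measurable g) (v : ℝ≥0) :
    (μ.prod (gaussianReal 0 v)).map (fun p => (p.1, p.2 + g p.1)) =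
      μ ⊗ₘ gaussianKernel g hg v := by
  have hT : Measurable fun p : β × ℝ => (p.1, p.2 + g p.1) := by fun_prop
  refine Measure.ext_of_lintegral _ fun f hf => ?_
  rw [lintegral_map hf hT, lintegral_prod _ (by fun_prop),
    Measure.lintegral_compProd hf]
  refine lintegral_congr fun x => ?_
  change _ = ∫⁻ y, f (x, y) ∂(gaussianReal (g x) v)
  rw [show gaussianReal (g x) v = (gaussianReal 0 v).map (· + g x) by
      rw [gaussianReal_map_add_const, zero_add],
    lintegral_map (by fun_prop) (by fun_prop)]

/-- The conditional law of `Y` given `X` is `N(g X, v)` exactly when `Y - g X` is an `N(0, v)`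
variable independent of `X`. -/
lemma condDistrib_eq_gaussianReal_iff {X : Ω → β} {Y : Ω → ℝ} {g : β → ℝ} {v : ℝ≥0}
    (hX : Measurable X) (hY : Measurable Y) (hg : Measurable g) :
    (∀ᵐ ω ∂P, condDistrib Y X P (X ω) = gaussianReal (g (X ω)) v) ↔
      IndepFun X (fun ω => Y ω - g (X ω)) P ∧
        P.map (fun ω => Y ω - g (X ω)) = gaussianReal 0 v := by
  have := Measure.isProbabilityMeasure_map hX.aemeasurable (μ := P)
  have hR : Measurable fun ω => Y ω - g (X ω) := by fun_prop
  have hT : Measurable fun p : β × ℝ => (p.1, p.2 + g p.1) := by fun_prop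
  have hT' : Measurable fun p : β × ℝ => (p.1, p.2 - g p.1) := by fun_prop
  have hker : (∀ᵐ ω ∂P, condDistrib Y X P (X ω) = gaussianReal (g (X ω)) v) ↔
      P.map (fun ω => (X ω, Y ω)) = P.map X ⊗ₘ gaussianKernel g hg v := by
    refine ⟨fun h => ?_, fun h => ae_of_ae_map hX.aemeasurable
      (condDistrib_ae_eq_of_measure_eq_compProd X hY.aemeasurable h)⟩
    rw [← compProd_map_condDistrib hY.aemeasurable]
    refine Measure.ext_of_lintegral _ fun f hf => ?_
    rw [Measure.lintegral_compProd hf, Measure.lintegral_compProd hf,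
      lintegral_map hf.lintegral_kernel_prod_right' hX,
      lintegral_map hf.lintegral_kernel_prod_right' hX]
    refine lintegral_congr_ae ?_
    filter_upwards [h] with ω hω
    rw [hω]
    rfl
  have hprod : IndepFun X (fun ω => Y ω - g (X ω)) P ∧
        P.map (fun ω => Y ω - g (X ω)) = gaussianReal 0 v ↔
      P.map (fun ω => (X ω, Y ω - g (X ω))) = (P.map X).prod (gaussianReal 0 v) := by
    rw [indepFun_iff_map_prod_eq_prod_map_map hX.aemeasurable hR.aemeasurable]
    refine ⟨fun h => by rw [h.1, h.2], fun h => ?_⟩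
    have h2 : P.map (fun ω => Y ω - g (X ω)) = gaussianReal 0 v := by
      rw [← Measure.snd_map_prodMk hX (μ := P), h, Measure.snd_prod]
    exact ⟨by rw [h, h2], h2⟩
  rw [hker, hprod, ← map_shear_prod_gaussianReal]
  constructor <;> intro h
  · have h' := congrArg (Measure.map fun p : β × ℝ => (p.1, p.2 - g p.1)) h
    rw [Measure.map_map hT' (by fun_prop), Measure.map_map hT' hT] at h'
    simpa [Function.comp_def] using h'
  · have h' := congrArg (Measure.map fun p : β × ℝ => (p.1, p.2 + g p.1)) h
    rw [Measure.map_map hT (by fun_prop)] at h'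
    simpa [Function.comp_def] using h'

end GaussianConditioning

/-! ### Gaussian spaces and linear regression -/

section GaussianSpace

variable {Ω : Type*} [MeasurableSpace Ω] {P : Measure Ω} [IsProbabilityMeasure P]

/-- A centered Gaussian space: a linear space of random variables each of which has a normal law
of mean `0`; point masses at `0` are allowed. -/
def IsCenteredGaussianSpace (P : Measure Ω) (M : Submodule ℝ (Ω → ℝ)) : Prop :=
  ∀ f ∈ M, Measurable f ∧ HasGaussianLaw f P ∧ ∫ ω, f ω ∂P = 0

omit [MeasurableSpace Ω] in
lemma measurable_of_mem_span {m : MeasurableSpace Ω} {s : Set (Ω → ℝ)}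
    (hs : ∀ f ∈ s, Measurable[m] f) {f : Ω → ℝ} (hf : f ∈ Submodule.span ℝ s) :
    Measurable[m] f := by
  induction hf using Submodule.span_induction with
  | mem f hf => exact hs f hf
  | zero => exact measurable_const
  | add f g _ _ hf hg => exact hf.add hg
  | smul c f _ hf => exact hf.const_smul c

namespace IsCenteredGaussianSpace

variable {M : Submodule ℝ (Ω → ℝ)}

omit [IsProbabilityMeasure P] in
lemma map_eq (hM : IsCenteredGaussianSpace P M) {f : Ω → ℝ} (hf : f ∈ M) :
    P.map f = gaussianReal 0 Var[f; P].toNNReal := by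
  obtain ⟨-, h, h0⟩ := hM f hf
  rw [h.map_eq_gaussianReal, h0]

lemma covariance_eq (hM : IsCenteredGaussianSpace P M) {f g : Ω → ℝ} (hf : f ∈ M) (hg : g ∈ M) :
    cov[f, g; P] = ∫ ω, f ω * g ω ∂P := by
  rw [covariance_eq_sub (hM f hf).2.1.memLp_two (hM g hg).2.1.memLp_two, (hM f hf).2.2]
  simp

/-- In a Gaussian space, a variable that is uncorrelated with each member of a finite family is
independent of the family. -/
lemma indepFun_of_orthogonal (hM : IsCenteredGaussianSpace P M) {ι : Type*} [Finite ι]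
    {X : ι → Ω → ℝ} {R : Ω → ℝ} (hX : ∀ k, X k ∈ M) (hR : R ∈ M)
    (h : ∀ k, ∫ ω, R ω * X k ω ∂P = 0) :
    IndepFun (fun ω k => X k ω) R P := by
  classical
  have := Fintype.ofFinite ι
  have hcomb : ∀ L : StrongDual ℝ (ι → ℝ), (fun ω => L fun k => X k ω) ∈ M := by
    intro L
    have : (fun ω => L fun k => X k ω) = ∑ k, L (fun j => if k = j then 1 else 0) • X k := by
      ext ω
      have := L.toLinearMap.pi_apply_eq_sum_univ fun k => X k ω
      simp only [ContinuousLinearMap.coe_coe] at this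
      simp [this, mul_comm]
    rw [this]
    exact M.sum_mem fun k _ => M.smul_mem _ (hX k)
  have hjoint : HasGaussianLaw (fun ω => ((fun k => X k ω), R ω)) P := by
    have hmeas : Measurable fun ω => ((fun k => X k ω), R ω) :=
      (measurable_pi_lambda _ fun k => (hM _ (hX k)).1).prodMk (hM R hR).1
    refine ⟨isGaussian_of_isGaussian_map fun L => ?_⟩
    rw [Measure.map_map (by fun_prop) hmeas]
    have hL : L ∘ (fun ω => ((fun k => X k ω), R ω)) =
        (fun ω => (L ∘L .inl ℝ (ι → ℝ) ℝ) fun k => X k ω) + L (0, 1) • R := by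
      ext ω
      have h : ((fun k => X k ω), R ω) =
          ((fun k => X k ω), (0 : ℝ)) + R ω • ((0 : ι → ℝ), (1 : ℝ)) := by simp
      simp only [Function.comp_apply, h, map_add, map_smul]
      simp [mul_comm]
    rw [hL]
    exact (hM _ (M.add_mem (hcomb _) (M.smul_mem _ hR))).2.1.isGaussian_map
  have hpair : IndepFun (fun ω k => X k ω) (fun ω (_ : Unit) => R ω) P := by
    refine HasGaussianLaw.indepFun_of_covariance_eval (X := X) (Y := fun _ : Unit => R)
      (hjoint.map ((ContinuousLinearMap.id ℝ (ι → ℝ)).prodMap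
        (ContinuousLinearMap.pi fun _ : Unit => .id ℝ ℝ))) fun k _ => ?_
    rw [hM.covariance_eq (hX k) hR, ← h k]
    simp [mul_comm]
  exact hpair.comp measurable_id (measurable_pi_apply ())

omit [IsProbabilityMeasure P] in
/-- Adjoining a variable whose deviation from a member of the space is a centered Gaussian
independent of the space keeps the space Gaussian. -/
lemma sup_span_singleton (hM : IsCenteredGaussianSpace P M) {x Y : Ω → ℝ} {v : ℝ≥0}
    (hx : x ∈ M) (hY : Measurable Y) (hind : ∀ f ∈ M, IndepFun f (Y - x) P)
    (hlaw : P.map (Y - x) = gaussianReal 0 v) :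
    IsCenteredGaussianSpace P (M ⊔ Submodule.span ℝ {Y}) := by
  intro f hf
  obtain ⟨f₁, hf₁, f₂, hf₂, rfl⟩ := Submodule.mem_sup.1 hf
  obtain ⟨c, rfl⟩ := Submodule.mem_span_singleton.1 hf₂
  have hz : Measurable (Y - x) := hY.sub (hM x hx).1
  have hzg : HasGaussianLaw (Y - x) P := ⟨by rw [hlaw]; infer_instance⟩
  have hz0 : ∫ ω, (Y - x) ω ∂P = 0 := by
    have := integral_map hz.aemeasurable (μ := P) (f := fun y : ℝ => y) (by fun_prop)
    rw [← this, hlaw, integral_id_gaussianReal]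
  have hmem : f₁ + c • x ∈ M := M.add_mem hf₁ (M.smul_mem c hx)
  obtain ⟨h1, h2, h3⟩ := hM _ hmem
  have heq : f₁ + c • Y = (f₁ + c • x) + c • (Y - x) := by
    rw [smul_sub]; abel
  have hcz := hzg.smul c
  rw [heq]
  refine ⟨h1.add (hz.const_smul c), ?_, ?_⟩
  · exact (IndepFun.hasGaussianLaw h2 hcz ((hind _ hmem).comp measurable_id
      (measurable_const_smul c))).add
  · rw [integral_add' h2.integrable hcz.integrable, h3]
    simp only [Pi.smul_apply, smul_eq_mul]
    rw [integral_const_mul, hz0]; simp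

end IsCenteredGaussianSpace

omit [IsProbabilityMeasure P] in
lemma coeFn_sum_smul_toLp {ι : Type*} (s : Finset ι) {X : ι → Ω → ℝ}
    (hX : ∀ k, MemLp (X k) 2 P) (c : ι → ℝ) :
    ⇑(∑ k ∈ s, c k • (hX k).toLp) =ᵐ[P] ∑ k ∈ s, c k • X k := by
  classical
  induction s using Finset.induction_on with
  | empty => simpa using Lp.coeFn_zero ℝ 2 P
  | insert k s hk ih =>
    rw [Finset.sum_insert hk, Finset.sum_insert hk]
    exact (Lp.coeFn_add _ _).trans
      (((Lp.coeFn_smul _ _).trans ((hX k).coeFn_toLp.const_smul (c k))).add ih)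

omit [IsProbabilityMeasure P] in
/-- Linear regression: a square integrable variable has a best approximation among the linear
combinations of a finite family. -/
lemma exists_mem_span_orthogonal {ι : Type*} [Finite ι] {X : ι → Ω → ℝ} {θ : Ω → ℝ}
    (hX : ∀ k, MemLp (X k) 2 P) (hθ : MemLp θ 2 P) :
    ∃ x ∈ Submodule.span ℝ (Set.range X), ∀ k, ∫ ω, (θ ω - x ω) * X k ω ∂P = 0 := by
  have := Fintype.ofFinite ι
  set K := Submodule.span ℝ (Set.range fun k => (hX k).toLp) with hK
  have hfin : FiniteDimensional ℝ K := FiniteDimensional.span_of_finite ℝ (Set.finite_range _)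
  obtain ⟨c, hc⟩ := (Submodule.mem_span_range_iff_exists_fun ℝ).1
    (K.starProjection_apply_mem hθ.toLp)
  refine ⟨∑ k, c k • X k, Submodule.sum_mem _ fun k _ =>
    Submodule.smul_mem _ _ (Submodule.subset_span ⟨k, rfl⟩), fun k => ?_⟩
  have h := K.starProjection_inner_eq_zero hθ.toLp (hX k).toLp
    (Submodule.subset_span ⟨k, rfl⟩)
  rw [← hc, MeasureTheory.L2.inner_def] at h
  rw [← h]
  refine integral_congr_ae ?_
  have hsum : ⇑(∑ k, c k • (hX k).toLp) =ᵐ[P] ∑ k, c k • X k :=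
    coeFn_sum_smul_toLp Finset.univ hX c
  filter_upwards [Lp.coeFn_sub hθ.toLp (∑ k, c k • (hX k).toLp), hsum, hθ.coeFn_toLp,
    (hX k).coeFn_toLp] with ω h1 h2 h3 h4
  rw [h1, Pi.sub_apply, h2, h3, h4]
  simp [mul_comm]

end GaussianSpace

/-! ### Linear combinations of independent normal variables -/

section SignalLaw

variable {V : Type*} [Fintype V]

/-- A linear combination of independent normal variables of variance `1` is normal. -/
lemma map_sum_mul_pi_gaussianReal (m u : V → ℝ) :
    (Measure.pi fun j => gaussianReal (m j) 1).map (fun x => ∑ j, u j * x j) =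
      gaussianReal (∑ j, u j * m j) (∑ j, u j ^ 2).toNNReal := by
  have hlaw : ∀ j, HasLaw (fun x : V → ℝ => x j) (gaussianReal (m j) 1)
      (Measure.pi fun j => gaussianReal (m j) 1) := fun j =>
    (measurePreserving_eval (fun j => gaussianReal (m j) 1) j).hasLaw
  have hgauss : HasGaussianLaw (fun x : V → ℝ => ∑ j, u j * x j)
      (Measure.pi fun j => gaussianReal (m j) 1) :=
    iIndepFun.hasGaussianLaw_fun_sum (X := fun j (x : V → ℝ) => u j * x j)
      (fun j => (gaussianReal_const_mul (hlaw j) (u j)).hasGaussianLaw)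
      (iIndepFun_pi (X := fun j (y : ℝ) => u j * y) fun j => by fun_prop)
  have hid : ∀ j, MemLp (fun y : ℝ => u j * y) 2 (gaussianReal (m j) 1) := fun j =>
    (memLp_id_gaussianReal' 2 (by simp)).const_mul (u j)
  rw [hgauss.map_eq_gaussianReal]
  congr 2
  · rw [integral_finsetSum]
    · refine Finset.sum_congr rfl fun j _ => ?_
      rw [integral_const_mul, integral_eval, integral_id_gaussianReal]
    · exact fun j _ => (gaussianReal_const_mul (hlaw j) (u j)).hasGaussianLaw.integrable
  · have h := variance_sum_pi (X := fun j (y : ℝ) => u j * y) hid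
    have hfun : (fun x : V → ℝ => ∑ j, u j * x j) = ∑ j, fun x : V → ℝ => u j * x j := by
      ext x
      simp
    rw [hfun, h]
    refine Finset.sum_congr rfl fun j _ => ?_
    rw [variance_const_mul, variance_fun_id_gaussianReal]
    simp

end SignalLaw

/-! ### Observed and past variables -/

section ObservationSpaces

variable {V Ω : Type*}

/-- The variables observed by agent `i` before time `t`: the signal and the neighbours' messages. -/
def observedVars (G : SimpleGraph V) (S : V → Ω → ℝ) (Y : V → ℕ → Ω → ℝ) (i : V) (t : ℕ) :
    Set (Ω → ℝ) :=
  insert (S i) {f | ∃ j r, G.Adj i j ∧ r < t ∧ f = Y j r}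

/-- The state, all signals, all messages sent before time `t`, and the messages sent at time `t`
by the agents in `s`. -/
def pastVars (θ : Ω → ℝ) (S : V → Ω → ℝ) (Y : V → ℕ → Ω → ℝ) (t : ℕ) (s : Set V) :
    Set (Ω → ℝ) :=
  insert θ (Set.range S ∪ {f | ∃ j r, r < t ∧ f = Y j r} ∪ (fun j => Y j t) '' s)

lemma observedVars_finite [Finite V] (G : SimpleGraph V) (S : V → Ω → ℝ) (Y : V → ℕ → Ω → ℝ)
    (i : V) (t : ℕ) : (observedVars G S Y i t).Finite := by
  refine Set.Finite.insert _ ?_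
  refine (Set.finite_range fun p : V × Fin t => Y p.1 p.2).subset ?_
  rintro f ⟨j, r, -, hr, rfl⟩
  exact ⟨(j, ⟨r, hr⟩), rfl⟩

lemma observedVars_subset_pastVars (G : SimpleGraph V) (θ : Ω → ℝ) (S : V → Ω → ℝ)
    (Y : V → ℕ → Ω → ℝ) (i : V) (t : ℕ) (s : Set V) :
    observedVars G S Y i t ⊆ pastVars θ S Y t s := by
  rintro f (rfl | ⟨j, r, -, hr, rfl⟩)
  · exact Or.inr (Or.inl (Or.inl ⟨i, rfl⟩))
  · exact Or.inr (Or.inl (Or.inr ⟨j, r, hr, rfl⟩))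

lemma pastVars_insert (θ : Ω → ℝ) (S : V → Ω → ℝ) (Y : V → ℕ → Ω → ℝ) (t : ℕ) (k : V) (s : Set V) :
    pastVars θ S Y t (insert k s) = pastVars θ S Y t s ∪ {Y k t} := by
  ext f
  simp only [pastVars, Set.mem_insert_iff, Set.mem_union, Set.image_insert_eq,
    Set.mem_singleton_iff]
  tauto

lemma pastVars_succ (θ : Ω → ℝ) (S : V → Ω → ℝ) (Y : V → ℕ → Ω → ℝ) (t : ℕ) :
    pastVars θ S Y (t + 1) ∅ = pastVars θ S Y t Set.univ := by
  ext f
  simp only [pastVars, Set.mem_insert_iff, Set.mem_union, Set.mem_ofPred_eq, Set.image_empty,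
    Set.mem_empty_iff_false, or_false, Set.image_univ, Set.mem_range, Order.lt_add_one_iff,
    le_iff_lt_or_eq]
  constructor
  · rintro (h | h | ⟨j, r, hr | rfl, rfl⟩)
    · exact Or.inl h
    · exact Or.inr (Or.inl (Or.inl h))
    · exact Or.inr (Or.inl (Or.inr ⟨j, r, hr, rfl⟩))
    · exact Or.inr (Or.inr ⟨j, rfl⟩)
  · rintro (h | (h | ⟨j, r, hr, rfl⟩) | ⟨j, rfl⟩)
    · exact Or.inl h
    · exact Or.inr (Or.inl h)
    · exact Or.inr (Or.inr ⟨j, r, Or.inl hr, rfl⟩)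
    · exact Or.inr (Or.inr ⟨j, t, Or.inr rfl, rfl⟩)

/-- An observed variable is a function of the history. -/
lemma measurable_comap_agentHistory {G : SimpleGraph V} {S : V → Ω → ℝ} {Y : V → ℕ → Ω → ℝ} {i : V}
    {t : ℕ} {f : Ω → ℝ} (hf : f ∈ Submodule.span ℝ (observedVars G S Y i t)) :
    Measurable[MeasurableSpace.comap (agentHistory G S Y i t) inferInstance] f := by
  have hH : Measurable[MeasurableSpace.comap (agentHistory G S Y i t) inferInstance]
      (agentHistory G S Y i t) := comap_measurable _
  refine measurable_of_mem_span ?_ hf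
  rintro f (rfl | ⟨j, r, hij, hr, rfl⟩)
  · exact measurable_fst.comp hH
  · exact (((measurable_pi_apply (⟨r, hr⟩ : Fin t)).comp
      (measurable_pi_apply (⟨j, hij⟩ : G.neighborSet i))).comp measurable_snd).comp hH

/-- The messages of the agents other than `i` at time `t`, and everything realised earlier, are
functions of the information on which the message of `i` is conditioned. -/
lemma measurable_comap_otherInfo {θ : Ω → ℝ} {S : V → Ω → ℝ} {Y : V → ℕ → Ω → ℝ} {i : V}
    {t : ℕ} {s : Set V} (hi : i ∉ s) {f : Ω → ℝ}
    (hf : f ∈ Submodule.span ℝ (pastVars θ S Y t s)) :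
    Measurable[MeasurableSpace.comap (otherInfo θ S Y i t) inferInstance] f := by
  have hO : Measurable[MeasurableSpace.comap (otherInfo θ S Y i t) inferInstance]
      (otherInfo θ S Y i t) := comap_measurable _
  refine measurable_of_mem_span ?_ hf
  rintro f (rfl | ((⟨j, rfl⟩ | ⟨j, r, hr, rfl⟩) | ⟨j, hj, rfl⟩))
  · exact measurable_fst.comp hO
  · exact ((measurable_pi_apply j).comp (measurable_fst.comp measurable_snd)).comp hO
  · exact (((measurable_pi_apply (⟨r, hr⟩ : Fin t)).comp (measurable_pi_apply j)).comp
      (measurable_fst.comp (measurable_snd.comp measurable_snd))).comp hO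
  · exact ((measurable_pi_apply (⟨j, fun h => hi (h ▸ hj)⟩ : {j : V // j ≠ i})).comp
      (measurable_snd.comp (measurable_snd.comp measurable_snd))).comp hO

end ObservationSpaces

/-! ### Posteriors in the Gaussian sampling model -/

section Model

variable {V Ω : Type*} [Fintype V] [MeasurableSpace Ω] {G : SimpleGraph V} {a : V → ℝ}
  {P : Measure Ω} [IsProbabilityMeasure P] {θ : Ω → ℝ} {S : V → Ω → ℝ} {Y : V → ℕ → Ω → ℝ}

/-- The noise in the combination of the signals with coefficients `u`, namely
`∑ u_j (S_j - a_j θ)`. -/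
noncomputable def signalNoise (a : V → ℝ) (θ : Ω → ℝ) (S : V → Ω → ℝ) (u : V → ℝ) : Ω → ℝ :=
  fun ω => ∑ j, u j * S j ω - (∑ j, u j * a j) * θ ω

section Signals

variable (hmodel : IsSamplingModel G (gaussianReal 0 1) (fun i x => gaussianReal (a i * x) 1) P θ S Y)

include hmodel

/-- The noise in the signals is normal and independent of the state. -/
lemma signalNoise_indepFun_map (u : V → ℝ) :
    IndepFun θ (signalNoise a θ S u) P ∧
      P.map (signalNoise a θ S u) = gaussianReal 0 (∑ j, u j ^ 2).toNNReal := by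
  have hS : Measurable fun ω j => S j ω := measurable_pi_lambda _ hmodel.measurable_signal
  refine (condDistrib_eq_gaussianReal_iff (Y := fun ω => ∑ j, u j * S j ω)
    (g := fun x => (∑ j, u j * a j) * x) hmodel.measurable_state
    (Finset.measurable_sum _ fun j _ => (hmodel.measurable_signal j).const_mul _)
    (by fun_prop)).1 ?_
  have hcomp := ae_of_ae_map hmodel.measurable_state.aemeasurable
    (condDistrib_comp θ hS.aemeasurable (μ := P)
      (f := fun x : V → ℝ => ∑ j, u j * x j) (by fun_prop))
  filter_upwards [hcomp, hmodel.law_signal] with ω h1 h2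
  rw [Function.comp_def] at h1
  rw [h1, Kernel.map_apply _ (by fun_prop), h2, map_sum_mul_pi_gaussianReal, Finset.sum_mul]
  simp only [mul_assoc]

lemma hasGaussianLaw_state : HasGaussianLaw θ P :=
  ⟨by rw [hmodel.law_state]; infer_instance⟩

lemma hasGaussianLaw_signalNoise (u : V → ℝ) : HasGaussianLaw (signalNoise a θ S u) P :=
  ⟨by rw [(signalNoise_indepFun_map hmodel u).2]; infer_instance⟩

lemma integral_state : ∫ ω, θ ω ∂P = 0 := by
  rw [← integral_map (f := fun y : ℝ => y) hmodel.measurable_state.aemeasurable (by fun_prop),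
    hmodel.law_state, integral_id_gaussianReal]

lemma integral_signalNoise (u : V → ℝ) : ∫ ω, signalNoise a θ S u ω ∂P = 0 := by
  rw [← integral_map (f := fun y : ℝ => y) (hasGaussianLaw_signalNoise hmodel u).aemeasurable
    (by fun_prop), (signalNoise_indepFun_map hmodel u).2, integral_id_gaussianReal]

lemma variance_signalNoise (u : V → ℝ) : Var[signalNoise a θ S u; P] = ∑ j, u j ^ 2 := by
  have h : HasLaw (signalNoise a θ S u) (gaussianReal 0 (∑ j, u j ^ 2).toNNReal) P :=
    ⟨(hasGaussianLaw_signalNoise hmodel u).aemeasurable, (signalNoise_indepFun_map hmodel u).2⟩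
  rw [h.variance_eq, variance_id_gaussianReal,
    Real.coe_toNNReal _ (Finset.sum_nonneg fun j _ => sq_nonneg _)]

lemma variance_state : Var[θ; P] = 1 := by
  have h : HasLaw θ (gaussianReal 0 1) P := ⟨hmodel.measurable_state.aemeasurable, hmodel.law_state⟩
  rw [h.variance_eq, variance_id_gaussianReal, NNReal.coe_one]

lemma covariance_state_signalNoise (u : V → ℝ) : cov[θ, signalNoise a θ S u; P] = 0 :=
  (signalNoise_indepFun_map hmodel u).1.covariance_eq_zero (hasGaussianLaw_state hmodel).memLp_two
    (hasGaussianLaw_signalNoise hmodel u).memLp_two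

lemma covariance_signalNoise (u w : V → ℝ) :
    cov[signalNoise a θ S u, signalNoise a θ S w; P] = ∑ j, u j * w j := by
  have hadd : signalNoise a θ S (u + w) = signalNoise a θ S u + signalNoise a θ S w := by
    ext ω
    simp only [signalNoise, Pi.add_apply, add_mul, Finset.sum_add_distrib]
    ring
  have h := variance_add (hasGaussianLaw_signalNoise hmodel u).memLp_two
    (hasGaussianLaw_signalNoise hmodel w).memLp_two
  rw [← hadd, variance_signalNoise hmodel, variance_signalNoise hmodel,
    variance_signalNoise hmodel] at h
  have hsq : ∑ j, (u + w) j ^ 2 = ∑ j, u j ^ 2 + 2 * ∑ j, u j * w j + ∑ j, w j ^ 2 := by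
    rw [Finset.mul_sum, ← Finset.sum_add_distrib, ← Finset.sum_add_distrib]
    refine Finset.sum_congr rfl fun j _ => ?_
    rw [Pi.add_apply]
    ring
  linarith

lemma isCenteredGaussianSpace_zero :
    IsCenteredGaussianSpace P (Submodule.span ℝ (pastVars θ S Y 0 ∅)) := by
  intro f hf
  have hvars : pastVars θ S Y 0 ∅ = insert θ (Set.range S) := by
    simp [pastVars]
  rw [hvars] at hf
  obtain ⟨c, g, hg, rfl⟩ := Submodule.mem_span_insert.1 hf
  obtain ⟨u, rfl⟩ := (Submodule.mem_span_range_iff_exists_fun ℝ).1 hg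
  have heq : c • θ + ∑ j, u j • S j = (c + ∑ j, u j * a j) • θ + signalNoise a θ S u := by
    ext ω
    simp [signalNoise]
    ring
  have hm : Measurable (signalNoise a θ S u) :=
    (Finset.measurable_sum _ fun j _ => (hmodel.measurable_signal j).const_mul _).sub
      (hmodel.measurable_state.const_mul _)
  have h1 := (hasGaussianLaw_state hmodel).smul (c + ∑ j, u j * a j)
  have h2 := hasGaussianLaw_signalNoise hmodel u
  rw [heq]
  refine ⟨(hmodel.measurable_state.const_smul _).add hm, ?_, ?_⟩
  · exact (IndepFun.hasGaussianLaw h1 h2 ((signalNoise_indepFun_map hmodel u).1.comp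
      (measurable_const_smul (c + ∑ j, u j * a j)) measurable_id)).add
  · rw [integral_add' h1.integrable h2.integrable, integral_signalNoise hmodel]
    simp only [Pi.smul_apply, smul_eq_mul]
    rw [integral_const_mul, integral_state hmodel]
    simp

/-- The variable `θ - ∑ a_j (S_j - a_j θ)` is a multiple of the error of the full-information
estimate, so the latter is uncorrelated with every signal. -/
lemma covariance_error_signal (k : V) :
    cov[θ - signalNoise a θ S a, S k; P] = 0 := by
  classical
  have hk : S k = a k • θ + signalNoise a θ S (Pi.single k 1) := by
    ext ω
    simp [signalNoise, Pi.single_apply]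
  have hθ := (hasGaussianLaw_state hmodel).memLp_two
  have hN := fun u => (hasGaussianLaw_signalNoise hmodel u).memLp_two
  rw [hk, covariance_add_right (hθ.sub (hN a)) (hθ.const_smul _) (hN _),
    covariance_smul_right, covariance_sub_left hθ (hN a) hθ, covariance_sub_left hθ (hN a) (hN _),
    covariance_self hθ.aemeasurable, variance_state hmodel, covariance_comm _ θ,
    covariance_state_signalNoise hmodel, covariance_state_signalNoise hmodel,
    covariance_signalNoise hmodel]
  simp [Pi.single_apply]

lemma variance_error : Var[θ - signalNoise a θ S a; P] = ∑ j, a j ^ 2 + 1 := by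
  rw [variance_sub (hasGaussianLaw_state hmodel).memLp_two
    (hasGaussianLaw_signalNoise hmodel a).memLp_two, covariance_state_signalNoise hmodel,
    variance_state hmodel, variance_signalNoise hmodel]
  ring

end Signals

/-- The posterior of agent `i` at time `t` is `N(x, v)`, where `x` is the linear regression of the
state on the observations of the agent and `v` is the variance of the error of the regression. -/
structure IsLinearPosterior (G : SimpleGraph V) (P : Measure Ω) [IsProbabilityMeasure P]
    (θ : Ω → ℝ) (S : V → Ω → ℝ) (Y : V → ℕ → Ω → ℝ) (i : V) (t : ℕ) (x : Ω → ℝ) (v : ℝ≥0) :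
    Prop where
  mem_span : x ∈ Submodule.span ℝ (observedVars G S Y i t)
  orthogonal : ∀ f ∈ observedVars G S Y i t, ∫ ω, (θ ω - x ω) * f ω ∂P = 0
  map_error : P.map (θ - x) = gaussianReal 0 v
  posterior_eq : ∀ᵐ ω ∂P, agentPosterior G P θ S Y i t ω = gaussianReal (x ω) v

omit [Fintype V] in
lemma measurable_agentHistory (hS : ∀ i, Measurable (S i)) (hY : ∀ i t, Measurable (Y i t))
    (i : V) (t : ℕ) : Measurable (agentHistory G S Y i t) :=
  (hS i).prodMk (measurable_pi_lambda _ fun j => measurable_pi_lambda _ fun s => hY j s)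

omit [Fintype V] in
lemma measurable_otherInfo (hθ : Measurable θ) (hS : ∀ i, Measurable (S i))
    (hY : ∀ i t, Measurable (Y i t)) (i : V) (t : ℕ) : Measurable (otherInfo θ S Y i t) :=
  hθ.prodMk ((measurable_pi_lambda _ hS).prodMk (Measurable.prodMk
    (measurable_pi_lambda _ fun j => measurable_pi_lambda _ fun s => hY j s)
    (measurable_pi_lambda _ fun j => hY j t)))

/-- If the past is Gaussian then so is the posterior: the error of the regression is orthogonal to
the observations, hence independent of the history. -/
lemma exists_isLinearPosterior
    (hgauss : IsCenteredGaussianSpace P (Submodule.span ℝ (pastVars θ S Y t ∅)))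
    (hS : ∀ i, Measurable (S i)) (hY : ∀ i t, Measurable (Y i t)) (i : V) :
    ∃ x v, IsLinearPosterior G P θ S Y i t x v := by
  have hθM : θ ∈ Submodule.span ℝ (pastVars θ S Y t ∅) :=
    Submodule.subset_span (Set.mem_insert _ _)
  have hOM : ∀ f ∈ observedVars G S Y i t, f ∈ Submodule.span ℝ (pastVars θ S Y t ∅) :=
    fun f hf => Submodule.subset_span (observedVars_subset_pastVars G θ S Y i t ∅ hf)
  have hfin : Finite (observedVars G S Y i t) := observedVars_finite G S Y i t
  obtain ⟨x, hx, horth⟩ := exists_mem_span_orthogonal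
    (X := ((↑) : observedVars G S Y i t → Ω → ℝ)) (P := P) (θ := θ)
    (fun k => (hgauss _ (hOM _ k.2)).2.1.memLp_two) (hgauss _ hθM).2.1.memLp_two
  rw [Subtype.range_coe] at hx
  have hxM : x ∈ Submodule.span ℝ (pastVars θ S Y t ∅) := Submodule.span_le.2 hOM hx
  have hRM := Submodule.sub_mem _ hθM hxM
  have hind : IndepFun (fun ω (k : observedVars G S Y i t) => (k : Ω → ℝ) ω) (θ - x) P :=
    hgauss.indepFun_of_orthogonal (fun k => hOM _ k.2) hRM horth
  obtain ⟨g, hg, hgx⟩ := (measurable_comap_agentHistory hx).exists_eq_measurable_comp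
  have hindH : IndepFun (agentHistory G S Y i t) (θ - x) P := by
    let φ : (observedVars G S Y i t → ℝ) → ℝ × (G.neighborSet i → Fin t → ℝ) := fun p =>
      (p ⟨S i, Set.mem_insert _ _⟩,
        fun j r => p ⟨Y j r, Or.inr ⟨j, r, j.2, r.2, rfl⟩⟩)
    have hφ : Measurable φ := by fun_prop
    exact hind.comp hφ measurable_id
  refine ⟨x, Var[θ - x; P].toNNReal, hx, fun f hf => horth ⟨f, hf⟩, hgauss.map_eq hRM, ?_⟩
  have hsub : (θ - x) = fun ω => θ ω - g (agentHistory G S Y i t ω) := by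
    ext ω
    simp [hgx]
  have hmap := hgauss.map_eq hRM
  have h := (condDistrib_eq_gaussianReal_iff (v := Var[θ - x; P].toNNReal)
    (measurable_agentHistory hS hY i t) (hgauss _ hθM).1 hg).2 (by
      rw [← hsub]
      exact ⟨hindH, hmap⟩)
  filter_upwards [h] with ω hω
  rw [agentPosterior, hω, hgx]
  rfl

/-- The noise that an agent adds to the posterior mean is independent of all other information. -/
lemma IsLinearPosterior.indepFun_otherInfo {ν : Measure ℝ} {Q : V → ℝ → Measure ℝ}
    (hmodel : IsSamplingModel G ν Q P θ S Y) {i : V} {t : ℕ} {x : Ω → ℝ} {v : ℝ≥0}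
    (hx : IsLinearPosterior G P θ S Y i t x v) :
    IndepFun (otherInfo θ S Y i t) (Y i t - x) P ∧ P.map (Y i t - x) = gaussianReal 0 v := by
  have hxO : Measurable[MeasurableSpace.comap (otherInfo θ S Y i t) inferInstance] x :=
    measurable_comap_otherInfo (Set.notMem_empty i)
      (Submodule.span_mono (observedVars_subset_pastVars G θ S Y i t ∅) hx.mem_span)
  obtain ⟨g, hg, hgx⟩ := hxO.exists_eq_measurable_comp
  have hsub : (Y i t - x) = fun ω => Y i t ω - g (otherInfo θ S Y i t ω) := by
    ext ω
    simp [hgx]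
  rw [hsub]
  refine (condDistrib_eq_gaussianReal_iff (measurable_otherInfo hmodel.measurable_state
    hmodel.measurable_signal hmodel.measurable_sample i t) (hmodel.measurable_sample i t) hg).1 ?_
  filter_upwards [hmodel.law_sample i t, hx.posterior_eq] with ω h1 h2
  rw [h1, h2, hgx]
  rfl

lemma IsLinearPosterior.indepFun_of_mem_span {ν : Measure ℝ} {Q : V → ℝ → Measure ℝ}
    (hmodel : IsSamplingModel G ν Q P θ S Y) {i : V} {t : ℕ} {x : Ω → ℝ} {v : ℝ≥0}
    (hx : IsLinearPosterior G P θ S Y i t x v) {s : Set V} (hi : i ∉ s) {f : Ω → ℝ}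
    (hf : f ∈ Submodule.span ℝ (pastVars θ S Y t s)) : IndepFun f (Y i t - x) P := by
  have h := (IndepFun_iff_Indep _ _ _).1 (hx.indepFun_otherInfo hmodel).1
  exact (IndepFun_iff_Indep _ _ _).2
    (indep_of_indep_of_le_left h (measurable_comap_otherInfo hi hf).comap_le)

/-- The messages of one round extend a Gaussian past to a Gaussian past. -/
lemma isCenteredGaussianSpace_succ {ν : Measure ℝ} {Q : V → ℝ → Measure ℝ}
    (hmodel : IsSamplingModel G ν Q P θ S Y) {t : ℕ}
    (h : IsCenteredGaussianSpace P (Submodule.span ℝ (pastVars θ S Y t ∅))) :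
    IsCenteredGaussianSpace P (Submodule.span ℝ (pastVars θ S Y (t + 1) ∅)) := by
  classical
  have hfin : ∀ s : Finset V,
      IsCenteredGaussianSpace P (Submodule.span ℝ (pastVars θ S Y t (s : Set V))) := by
    intro s
    induction s using Finset.induction_on with
    | empty => simpa using h
    | insert k s hk ih =>
      -- The messages of the agents in `s` belong to the information given which the message of
      -- `k` is sampled.
      obtain ⟨x, v, hx⟩ := exists_isLinearPosterior (G := G) h hmodel.measurable_signal
        hmodel.measurable_sample k
      rw [Finset.coe_insert, pastVars_insert, Submodule.span_union]
      exact ih.sup_span_singleton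
        (Submodule.span_mono (observedVars_subset_pastVars G θ S Y k t _) hx.mem_span)
        (hmodel.measurable_sample k t)
        (fun f hf => hx.indepFun_of_mem_span hmodel (by simpa using hk) hf)
        (hx.indepFun_otherInfo hmodel).2
  rw [pastVars_succ]
  simpa using hfin Finset.univ

end Model

/-! ### Square integrable variables as elements of the Hilbert space -/

section SquareIntegrable

open scoped InnerProductSpace

variable {Ω : Type*} [MeasurableSpace Ω] {P : Measure Ω}

lemma inner_toLp_toLp_eq_integral {f g : Ω → ℝ} (hf : MemLp f 2 P) (hg : MemLp g 2 P) :
    ⟪hf.toLp f, hg.toLp g⟫_ℝ = ∫ ω, f ω * g ω ∂P := by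
  rw [L2.inner_def]
  refine integral_congr_ae ?_
  filter_upwards [hf.coeFn_toLp, hg.coeFn_toLp] with ω h1 h2
  rw [h1, h2]
  simp [mul_comm]

lemma toLp_mem_of_mem_span {s : Set (Ω → ℝ)} {K : Submodule ℝ (Lp ℝ 2 P)}
    (hs : ∀ f ∈ s, ∃ hf : MemLp f 2 P, hf.toLp f ∈ K) {f : Ω → ℝ}
    (hf : f ∈ Submodule.span ℝ s) : ∃ hf : MemLp f 2 P, hf.toLp f ∈ K := by
  induction hf using Submodule.span_induction with
  | mem f hf => exact hs f hf
  | zero => exact ⟨MemLp.zero', K.zero_mem⟩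
  | add f g _ _ hf hg =>
    obtain ⟨hf, hfK⟩ := hf
    obtain ⟨hg, hgK⟩ := hg
    exact ⟨hf.add hg, K.add_mem hfK hgK⟩
  | smul c f _ hf =>
    obtain ⟨hf, hfK⟩ := hf
    exact ⟨hf.const_smul c, K.smul_mem c hfK⟩

lemma norm_toLp_sq_of_map_eq {f : Ω → ℝ} (hf : MemLp f 2 P) {v : ℝ≥0}
    (h : P.map f = gaussianReal 0 v) : ‖hf.toLp f‖ ^ 2 = v := by
  have hlaw : HasLaw f (gaussianReal 0 v) P := ⟨hf.aemeasurable, h⟩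
  have h0 : ∫ ω, f ω ∂P = 0 := by
    rw [← integral_map (f := fun y : ℝ => y) hf.aemeasurable (by fun_prop), h,
      integral_id_gaussianReal]
  rw [← real_inner_self_eq_norm_sq, inner_toLp_toLp_eq_integral]
  have hv := hlaw.variance_eq
  rw [variance_id_gaussianReal, variance_of_integral_eq_zero hf.aemeasurable h0] at hv
  rw [← hv]
  simp [sq]

end SquareIntegrable

/-! ### Convergence of the posteriors -/

section Convergence

open scoped InnerProductSpace

variable {V Ω : Type*} [Fintype V] [MeasurableSpace Ω] {G : SimpleGraph V} {a : V → ℝ}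
  {P : Measure Ω} [IsProbabilityMeasure P] {θ : Ω → ℝ} {S : V → Ω → ℝ} {Y : V → ℕ → Ω → ℝ}

/-- The posterior mean of the state given all signals. -/
noncomputable def fullInfoMean (a : V → ℝ) (S : V → Ω → ℝ) (ω : Ω) : ℝ :=
  (∑ j, a j * S j ω) / (∑ j, a j ^ 2 + 1)

lemma sum_sq_add_one_pos (a : V → ℝ) : 0 < ∑ j, a j ^ 2 + 1 := by
  have := Finset.sum_nonneg fun j (_ : j ∈ Finset.univ) => sq_nonneg (a j)
  linarith

omit [MeasurableSpace Ω] in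
lemma state_sub_fullInfoMean (a : V → ℝ) (θ : Ω → ℝ) (S : V → Ω → ℝ) :
    θ - fullInfoMean a S = (∑ j, a j ^ 2 + 1)⁻¹ • (θ - signalNoise a θ S a) := by
  ext ω
  have := (sum_sq_add_one_pos a).ne'
  simp only [Pi.sub_apply, Pi.smul_apply, smul_eq_mul, fullInfoMean, signalNoise, ← sq]
  field_simp
  ring

omit [MeasurableSpace Ω] in
lemma fullInfoMean_mem_span (a : V → ℝ) (S : V → Ω → ℝ) :
    fullInfoMean a S ∈ Submodule.span ℝ (Set.range S) := by
  have : fullInfoMean a S = ∑ j, (a j / (∑ j, a j ^ 2 + 1)) • S j := by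
    ext ω
    simp [fullInfoMean, Finset.sum_div, div_mul_eq_mul_div]
  rw [this]
  exact Submodule.sum_mem _ fun j _ => Submodule.smul_mem _ _ (Submodule.subset_span ⟨j, rfl⟩)

variable (hmodel : IsSamplingModel G (gaussianReal 0 1) (fun i x => gaussianReal (a i * x) 1) P θ S Y)

include hmodel

/-- The state, the signals and the messages form a centered Gaussian family. -/
lemma isCenteredGaussianSpace_past (t : ℕ) :
    IsCenteredGaussianSpace P (Submodule.span ℝ (pastVars θ S Y t ∅)) := by
  induction t with
  | zero => exact isCenteredGaussianSpace_zero hmodel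
  | succ t ih => exact isCenteredGaussianSpace_succ hmodel ih

lemma memLp_state : MemLp θ 2 P :=
  (hasGaussianLaw_state hmodel).memLp_two

lemma memLp_signal (j : V) : MemLp (S j) 2 P :=
  (isCenteredGaussianSpace_past hmodel 0 _
    (Submodule.subset_span (Or.inr (Or.inl (Or.inl ⟨j, rfl⟩))))).2.1.memLp_two

lemma memLp_sample (j : V) (t : ℕ) : MemLp (Y j t) 2 P :=
  (isCenteredGaussianSpace_past hmodel (t + 1) _
    (Submodule.subset_span (Or.inr (Or.inl (Or.inr ⟨j, t, t.lt_succ_self, rfl⟩))))).2.1.memLp_two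

lemma memLp_fullInfoMean : MemLp (fullInfoMean a S) 2 P := by
  refine (toLp_mem_of_mem_span (K := ⊤) ?_ (fullInfoMean_mem_span a S)).1
  rintro _ ⟨j, rfl⟩
  exact ⟨memLp_signal hmodel j, trivial⟩

lemma IsLinearPosterior.memLp {i : V} {t : ℕ} {x : Ω → ℝ} {v : ℝ≥0}
    (hx : IsLinearPosterior G P θ S Y i t x v) : MemLp x 2 P := by
  refine (toLp_mem_of_mem_span (K := ⊤) ?_ hx.mem_span).1
  rintro _ (rfl | ⟨j, r, -, -, rfl⟩)
  · exact ⟨memLp_signal hmodel i, trivial⟩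
  · exact ⟨memLp_sample hmodel j r, trivial⟩

lemma IsLinearPosterior.integral_noise_mul {i : V} {t : ℕ} {x : Ω → ℝ} {v : ℝ≥0}
    (hx : IsLinearPosterior G P θ S Y i t x v) {f : Ω → ℝ} (hf : f ∈ pastVars θ S Y t ∅) :
    ∫ ω, (Y i t - x) ω * f ω ∂P = 0 := by
  have hfM : f ∈ Submodule.span ℝ (pastVars θ S Y t ∅) := Submodule.subset_span hf
  have hind := hx.indepFun_of_mem_span hmodel (Set.notMem_empty i) hfM
  obtain ⟨-, hfg, hf0⟩ := isCenteredGaussianSpace_past hmodel t f hfM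
  rw [hind.symm.integral_fun_mul_eq_mul_integral
    ((memLp_sample hmodel i t).sub (hx.memLp hmodel)).aestronglyMeasurable
    hfg.memLp_two.aestronglyMeasurable, hf0, mul_zero]

lemma integral_state_sub_signalNoise : P[θ - signalNoise a θ S a] = 0 := by
  rw [integral_sub' ((memLp_state hmodel).integrable one_le_two)
    (hasGaussianLaw_signalNoise hmodel a).integrable, integral_state hmodel,
    integral_signalNoise hmodel, sub_zero]

lemma integral_error_mul_signal (j : V) :
    ∫ ω, (θ - fullInfoMean a S) ω * S j ω ∂P = 0 := by
  have hN := (hasGaussianLaw_signalNoise hmodel a)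
  have hθ := memLp_state hmodel
  have h := covariance_error_signal hmodel j
  have h0 := integral_state_sub_signalNoise hmodel
  rw [covariance_eq_sub (hθ.sub hN.memLp_two) (memLp_signal hmodel j), h0, zero_mul,
    sub_zero] at h
  rw [state_sub_fullInfoMean]
  simp only [Pi.smul_apply, smul_eq_mul, mul_assoc]
  rw [integral_const_mul]
  exact mul_eq_zero_of_right _ h

/-- The mean square error of the full-information estimate. -/
lemma norm_error_sq :
    ‖((memLp_state hmodel).sub (memLp_fullInfoMean hmodel)).toLp (θ - fullInfoMean a S)‖ ^ 2 =
      1 / (∑ j, a j ^ 2 + 1) := by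
  have hN := (hasGaussianLaw_signalNoise hmodel a)
  have hθ := memLp_state hmodel
  have h0 := integral_state_sub_signalNoise hmodel
  have hvar := variance_error hmodel
  rw [variance_of_integral_eq_zero (hθ.sub hN.memLp_two).aemeasurable h0] at hvar
  have hpos := sum_sq_add_one_pos a
  rw [← real_inner_self_eq_norm_sq, inner_toLp_toLp_eq_integral]
  have hpt : ∀ ω, (θ - fullInfoMean a S) ω * (θ - fullInfoMean a S) ω =
      ((∑ j, a j ^ 2 + 1)⁻¹) ^ 2 * (θ - signalNoise a θ S a) ω ^ 2 := fun ω => by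
    rw [state_sub_fullInfoMean, Pi.smul_apply, smul_eq_mul]
    ring
  simp only [hpt]
  rw [integral_const_mul]
  have hvar' : ∫ ω, (θ - signalNoise a θ S a) ω ^ 2 ∂P = ∑ j, a j ^ 2 + 1 := by
    simpa using hvar
  rw [hvar']
  field_simp

/-- All agents learn the full-information estimate in `L²`: the Hilbert space theorem applied to the
linear posteriors. -/
lemma IsLinearPosterior.tendsto_toLp (hG : G.Connected) {x : V → ℕ → Ω → ℝ} {v : V → ℕ → ℝ≥0}
    (hx : ∀ i t, IsLinearPosterior G P θ S Y i t (x i t) (v i t)) (i : V) :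
    Tendsto (fun t => ((hx i t).memLp hmodel).toLp (x i t)) atTop
      (𝓝 ((memLp_fullInfoMean hmodel).toLp (fullInfoMean a S))) := by
  have hθ := memLp_state hmodel
  have hS := memLp_signal hmodel
  have hY := memLp_sample hmodel
  have hxm := fun i t => (hx i t).memLp hmodel
  have hz : ∀ i t (f : Ω → ℝ) (hf : MemLp f 2 P), f ∈ pastVars θ S Y t ∅ →
      ⟪(hY i t).toLp (Y i t) - (hxm i t).toLp (x i t), hf.toLp f⟫_ℝ = 0 := fun i t f hf hfp => by
    rw [← MemLp.toLp_sub, inner_toLp_toLp_eq_integral]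
    exact (hx i t).integral_noise_mul hmodel hfp
  refine tendsto_projection_of_connected hG (θ := hθ.toLp θ) (s := fun j => (hS j).toLp (S j))
    (x := fun i t => (hxm i t).toLp (x i t)) (y := fun i t => (hY i t).toLp (Y i t))
    (fun i t => ?_) (fun i t => ?_) (fun i t j r hij hr => ?_) (fun i t => ?_) (fun i t j => ?_)
    (fun i t j r hr => ?_) (fun i t => ?_) ?_ (fun j => ?_) i
  · refine (toLp_mem_of_mem_span ?_ (hx i t).mem_span).2
    rintro f (rfl | ⟨j, r, hij, hr, rfl⟩)
    · exact ⟨hS i, Submodule.subset_span (Or.inl rfl)⟩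
    · exact ⟨hY j r, Submodule.subset_span (Or.inr ⟨j, r, hij, hr, rfl⟩)⟩
  · rw [← MemLp.toLp_sub, inner_toLp_toLp_eq_integral]
    exact (hx i t).orthogonal _ (Or.inl rfl)
  · rw [← MemLp.toLp_sub, inner_toLp_toLp_eq_integral]
    exact (hx i t).orthogonal _ (Or.inr ⟨j, r, hij, hr, rfl⟩)
  · exact hz i t θ hθ (Or.inl rfl)
  · exact hz i t (S j) (hS j) (Or.inr (Or.inl (Or.inl ⟨j, rfl⟩)))
  · exact hz i t (Y j r) (hY j r) (Or.inr (Or.inl (Or.inr ⟨j, r, hr, rfl⟩)))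
  · -- The noise `Y - x` and the error `θ - x` have the same law `N(0, v)`.
    rw [← MemLp.toLp_sub, ← MemLp.toLp_sub]
    refine (sq_eq_sq₀ (norm_nonneg _) (norm_nonneg _)).1 ?_
    rw [norm_toLp_sq_of_map_eq _ ((hx i t).indepFun_otherInfo hmodel).2,
      norm_toLp_sq_of_map_eq _ (hx i t).map_error]
  · refine (toLp_mem_of_mem_span ?_ (fullInfoMean_mem_span a S)).2
    rintro _ ⟨j, rfl⟩
    exact ⟨hS j, Submodule.subset_span ⟨j, rfl⟩⟩
  · rw [← MemLp.toLp_sub, inner_toLp_toLp_eq_integral]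
    exact integral_error_mul_signal hmodel j

omit [Fintype V] hmodel in
lemma IsLinearPosterior.posteriorMean_ae_eq {i : V} {t : ℕ} {x : Ω → ℝ} {v : ℝ≥0}
    (hx : IsLinearPosterior G P θ S Y i t x v) : posteriorMean G P θ S Y i t =ᵐ[P] x := by
  filter_upwards [hx.posterior_eq] with ω hω
  rw [posteriorMean, hω, integral_id_gaussianReal]

omit [Fintype V] hmodel in
/-- By Lévy's upward theorem the posterior means converge almost surely. -/
lemma exists_tendsto_posteriorMean (hθ : Integrable θ P) (hS : ∀ i, Measurable (S i))
    (hY : ∀ i t, Measurable (Y i t)) (i : V) :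
    ∃ L : Ω → ℝ, ∀ᵐ ω ∂P, Tendsto (fun t => posteriorMean G P θ S Y i t ω) atTop (𝓝 (L ω)) := by
  let ℱ : Filtration ℕ (inferInstance : MeasurableSpace Ω) :=
    { seq := fun t => MeasurableSpace.comap (agentHistory G S Y i t) inferInstance
      mono' := by
        intro t t' h
        let φ : ℝ × (G.neighborSet i → Fin t' → ℝ) → ℝ × (G.neighborSet i → Fin t → ℝ) :=
          fun p => (p.1, fun j r => p.2 j (Fin.castLE h r))
        have hφ : Measurable φ := by fun_prop
        have : agentHistory G S Y i t = φ ∘ agentHistory G S Y i t' := rfl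
        simp only [this, ← MeasurableSpace.comap_comp]
        exact MeasurableSpace.comap_mono hφ.comap_le
      le' := fun t => (measurable_agentHistory hS hY i t).comap_le }
  have hcond : ∀ t, P[θ | ℱ t] =ᵐ[P] posteriorMean G P θ S Y i t := fun t =>
    condExp_ae_eq_integral_condDistrib' (measurable_agentHistory hS hY i t) hθ
  refine ⟨P[θ | ⨆ t, ℱ t], ?_⟩
  filter_upwards [tendsto_ae_condExp (ℱ := ℱ) (μ := P) θ, ae_all_iff.2 hcond] with ω h1 h2
  simpa only [h2] using h1

end Convergence

/-- In the Gaussian sampling model on a finite connected network, every posterior is a normal law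
with a deterministic variance; the posterior variances converge to `1 / (∑ a_j² + 1)` and the
posterior means to `∑ a_j S_j / (∑ a_j² + 1)`, almost surely and in `L²`. -/
theorem corollary4p2 {V : Type*} [Fintype V] (G : SimpleGraph V) (hG : G.Connected) (a : V → ℝ)
    {Ω : Type*} [MeasurableSpace Ω] (P : Measure Ω) [IsProbabilityMeasure P]
    (θ : Ω → ℝ) (S : V → Ω → ℝ) (Y : V → ℕ → Ω → ℝ)
    (hmodel : IsSamplingModel G (gaussianReal 0 1) (fun i x => gaussianReal (a i * x) 1) P θ S Y)
    (i : V) :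
    (∃ σ : ℕ → ℝ≥0,
      (∀ t, ∀ᵐ ω ∂P,
        agentPosterior G P θ S Y i t ω = gaussianReal (posteriorMean G P θ S Y i t ω) (σ t)) ∧
      Tendsto (fun t => (σ t : ℝ)) atTop (𝓝 (1 / (∑ j, a j ^ 2 + 1)))) ∧
    (∀ᵐ ω ∂P, Tendsto (fun t => posteriorMean G P θ S Y i t ω) atTop
      (𝓝 ((∑ j, a j * S j ω) / (∑ j, a j ^ 2 + 1)))) ∧
    (∀ t, MemLp (posteriorMean G P θ S Y i t) 2 P) ∧
    MemLp (fun ω => (∑ j, a j * S j ω) / (∑ j, a j ^ 2 + 1)) 2 P ∧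
    Tendsto (fun t => eLpNorm (fun ω => posteriorMean G P θ S Y i t ω -
      (∑ j, a j * S j ω) / (∑ j, a j ^ 2 + 1)) 2 P) atTop (𝓝 0) := by
  have hθ := memLp_state hmodel
  have hfull := memLp_fullInfoMean hmodel
  choose x v hx using fun i t => exists_isLinearPosterior (G := G)
    (isCenteredGaussianSpace_past hmodel t) hmodel.measurable_signal hmodel.measurable_sample i
  have hlim := IsLinearPosterior.tendsto_toLp hmodel hG hx i
  have hmean := fun t => (hx i t).posteriorMean_ae_eq
  have hmem : ∀ t, MemLp (posteriorMean G P θ S Y i t) 2 P := fun t =>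
    ((hx i t).memLp hmodel).ae_eq (hmean t).symm
  have hL2 : Tendsto (fun t => eLpNorm (posteriorMean G P θ S Y i t - fullInfoMean a S) 2 P) atTop
      (𝓝 0) := by
    refine ((Lp.tendsto_Lp_iff_tendsto_eLpNorm'' _ _ _ hfull).1 hlim).congr fun t => ?_
    exact eLpNorm_congr_ae ((hmean t).symm.sub EventuallyEq.rfl)
  refine ⟨⟨v i, fun t => ?_, ?_⟩, ?_, hmem, hfull, hL2⟩
  · filter_upwards [(hx i t).posterior_eq, hmean t] with ω h1 h2
    rw [h1, h2]
  · rw [← norm_error_sq hmodel, MemLp.toLp_sub hθ hfull]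
    refine ((tendsto_const_nhds.sub hlim).norm.pow 2).congr fun t => ?_
    rw [← MemLp.toLp_sub, norm_toLp_sq_of_map_eq _ (hx i t).map_error]
  · obtain ⟨L, hL⟩ := exists_tendsto_posteriorMean (G := G) (hθ.integrable one_le_two)
      hmodel.measurable_signal hmodel.measurable_sample i
    -- A subsequence of an `L²`-convergent sequence converges almost surely, which identifies the
    -- almost sure limit.
    obtain ⟨n, hn, hsub⟩ := (tendstoInMeasure_of_tendsto_eLpNorm two_ne_zero
      (fun t => (hmem t).aestronglyMeasurable) hfull.aestronglyMeasurable hL2).exists_seq_tendsto_ae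
    filter_upwards [hL, hsub] with ω h1 h2
    have : L ω = fullInfoMean a S ω :=
      tendsto_nhds_unique (h1.comp hn.tendsto_atTop) h2
    rw [this] at h1
    exact h1
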